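/- A finitely supported probability measure $\nu$ on a set $X$ is identified with its mass function $\nu : X \to [0,1]$, $\nu(x) = \nu(\{x\})$, with finite support $\mathrm{supp}(\nu) = \{x : \nu(x) \neq 0\}$. For such a measure $\mu$ on the real $2\times 2$ matrices $\mathrm{Mat}_2(\mathbb{R})$, put $$T(\mu) = \sum_{X, Y \in \mathrm{supp}(\mu),\ XY = YX} \mu(X)\mu(Y).$$ For a finitely supported probability measure $\nu$ on $\mathbb{R}$, let $\mu_\nu$ be the product measure on $\mathrm{Mat}_2(\mathbb{R})$, $$\mu_\nu\begin{pmatrix} a_1 & a_2 \\ a_3 & a_4\end{pmatrix} = \nu(a_1)\nu(a_2)\nu(a_3)\nu(a_4) \qquad (a_1, \dots, a_4 \in \mathbb{R}),$$ let $$M(\nu) = \sum_{\substack{a_1, a_2, a_3, a_4 \in \mathrm{supp}(\nu)\setminus\{0\} \\ a_1/a_2 = a_3/a_4}} \nu(a_1)\nu(a_2)\nu(a_3)\nu(a_4)$$ be its weighted multiplicative energy, and let $\|\nu\|_2 = \big(\sum_{x \in \mathrm{supp}(\nu)} \nu(x)^2\big)^{1/2}$ and $\|\nu\|_\infty = \max_{x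 \in \mathrm{supp}(\nu)} \nu(x)$. **Theorem 1.2.** There is an absolute constant $C > 0$ such that for every finitely supported probability measure $\nu$ on $\mathbb{R}$, $$T(\mu_\nu) \leq C\left( \|\nu\|_2^4\, M(\nu)^{1/2} + \|\nu\|_\infty^2\, M(\nu) + \|\nu\|_2^6 + \nu(0)^3 \right).$$ In particular, there is an absolute constant $C > 0$ such that for every finite set $A \subset \mathbb{R}$ with $|A| \geq 2$, $$T(A) \leq C\, |A|^4\, M(A)^{1/2},$$ where $T(A)$ is the number of ordered pairs $(X, Y)$ of $2 \times 2$ matrices with all entries in $A$ such that $XY = YX$, and $M(A)$ is the number of quadruples $(a_1, a_2, a_3, a_4)$ of elements of $A \setminus \{0\}$ with $a_1/a_2 = a_3/a_4$. -/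

import Mathlib

open Convexity

noncomputable section

namespace CommutingPairs

/-- Real `2 × 2` matrices. -/
abbrev Mat2 : Type := Matrix (Fin 2) (Fin 2) ℝ

/-- A finitely supported probability measure on `X`, given by its mass function
`x ↦ ν.weights x`, a nonnegative finitely supported function with total mass `1`. -/
abbrev FinProb (X : Type*) : Type _ := StdSimplex ℝ X

/-- The finite set of all real `2 × 2` matrices whose four entries all lie in `A`. -/
def matricesOver (A : Finset ℝ) : Finset Mat2 :=
  (Fintype.piFinset fun _ : Fin 2 => Fintype.piFinset fun _ : Fin 2 => A).map
    Matrix.of.toEmbedding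

theorem mem_matricesOver {A : Finset ℝ} {X : Mat2} :
    X ∈ matricesOver A ↔ ∀ i j, X i j ∈ A := by
  simp only [matricesOver, Finset.mem_map_equiv, Fintype.mem_piFinset, Matrix.of_symm_apply]

/-- The product measure `μ_ν` on real `2 × 2` matrices: the mass of the matrix `(a i j)` is the
product of the masses `ν (a i j)` of its four entries. -/
def productMeasure (ν : FinProb ℝ) : FinProb Mat2 where
  weights := Finsupp.onFinset (matricesOver ν.weights.support)
    (fun X => ∏ i, ∏ j, ν.weights (X i j)) (by
      intro X hX
      rw [mem_matricesOver]
      intro i j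
      rw [Finsupp.mem_support_iff]
      exact Finset.prod_ne_zero_iff.1 (Finset.prod_ne_zero_iff.1 hX i (Finset.mem_univ i)) j
        (Finset.mem_univ j))
  nonneg := fun X =>
    Finset.prod_nonneg fun _ _ => Finset.prod_nonneg fun _ _ => ν.weights_nonneg _
  total := by
    have h1 : ∑ x ∈ ν.weights.support, ν.weights x = 1 := ν.total
    rw [Finsupp.onFinset_sum _ (fun _ => rfl), matricesOver, Finset.sum_map]
    have h2 := Finset.prod_univ_sum
      (fun _ : Fin 2 => Fintype.piFinset fun _ : Fin 2 => ν.weights.support)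
      (fun _ (v : Fin 2 → ℝ) => ∏ j, ν.weights (v j))
    have h3 := Finset.prod_univ_sum (fun _ : Fin 2 => ν.weights.support)
      (fun _ (x : ℝ) => ν.weights x)
    simp only [h1, Finset.prod_const_one] at h3
    simp only [← h3, Finset.prod_const_one] at h2
    exact h2.symm

theorem productMeasure_apply (ν : FinProb ℝ) (X : Mat2) :
    (productMeasure ν).weights X =
      ν.weights (X 0 0) * ν.weights (X 0 1) * (ν.weights (X 1 0) * ν.weights (X 1 1)) := by
  simp [productMeasure, Fin.prod_univ_two]

/-- `T(μ)`: the `μ × μ`-mass of the set of commuting pairs of matrices. -/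
def T (μ : FinProb Mat2) : ℝ :=
  ∑ X ∈ μ.weights.support, ∑ Y ∈ μ.weights.support,
    μ.weights X * μ.weights Y * (if X * Y = Y * X then 1 else 0)

/-- The weighted multiplicative energy `M(ν)`. -/
def multEnergy (ν : FinProb ℝ) : ℝ :=
  ∑ a₁ ∈ ν.weights.support \ {0}, ∑ a₂ ∈ ν.weights.support \ {0},
    ∑ a₃ ∈ ν.weights.support \ {0}, ∑ a₄ ∈ ν.weights.support \ {0},
      ν.weights a₁ * ν.weights a₂ * ν.weights a₃ * ν.weights a₄ *
        (if a₁ / a₂ = a₃ / a₄ then 1 else 0)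

/-- The norm `‖ν‖_p = (∑ ν(x)^p)^(1/p)`, for `1 ≤ p < ∞`. -/
def lpNorm (p : ℝ) (ν : FinProb ℝ) : ℝ :=
  (∑ x ∈ ν.weights.support, ν.weights x ^ p) ^ (1 / p)

/-- The norm `‖ν‖_∞`, the largest mass of a point of the support. -/
def supNorm (ν : FinProb ℝ) : ℝ :=
  ν.weights.support.sup' ν.support_weights_nonempty fun x => ν.weights x

/-- `T(A)`: the number of ordered pairs of commuting `2 × 2` matrices with entries in `A`. -/
def commPairs (A : Finset ℝ) : ℕ :=
  ((matricesOver A ×ˢ matricesOver A).filter fun p => p.1 * p.2 = p.2 * p.1).card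

/-- `M(A)`: the number of quadruples `(a₁, a₂, a₃, a₄)` of nonzero elements of `A` with
`a₁ / a₂ = a₃ / a₄`. -/
def setMultEnergy (A : Finset ℝ) : ℕ :=
  (((A \ {0}) ×ˢ (A \ {0}) ×ˢ (A \ {0}) ×ˢ (A \ {0})).filter
    fun a => a.1 / a.2.1 = a.2.2.1 / a.2.2.2).card

end CommutingPairs

end

/-!
Write the two matrices as `!![x, p; p', y]` and `!![u, q; q', v]`. They commute exactly when the
vectors `(p, p', x - y)` and `(q, q', u - v)` are parallel.

If an off-diagonal entry vanishes, then either all four do, or two of them do, in one of four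
positions, and a nontrivial linear equation between `x - y` and `u - v` remains. As the
equation fixes one of the entries in terms of the others, these pairs have mass at most a multiple of
`ν(0)² ‖ν‖₂² + ν(0)³ ≤ ‖ν‖₂⁶ + 2 ν(0)³` (`expect_parallel_le`).

If no off-diagonal entry vanishes, then `p / q = p' / q' = r` and `x - y = r (u - v)`. For a fixed
`r` the last equation says that the points `(x, u)` and `(y, v)` lie on a common line of slope
determined by `r`. Cut the real line into `s` intervals at the `1 / s`-quantiles of `ν`, and the
plane into the resulting `s²` cells. A line that is not parallel to an axis runs through at most
`2 s` cells, because they form a chain, so by Cauchy–Schwarz the mass of the pairs of points on a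
common line is at most `2 s` times the mass of those which also share a cell (`diffEnergy_le`).
Such pairs either coincide, with mass `‖ν‖₂⁴`, or have `x ≠ y` in one interval and `u ≠ v` in one
interval, with mass at most `(2 / s)²` over all lines. In the second case `r` is determined by the
points, and then `p = r q` and `p' = r q'` have mass at most `‖ν‖₂⁴`. Altogether the
commuting pairs of this type have mass at most `2 s (M ‖ν‖₂⁴ + 4 ‖ν‖₂⁴ / s²)`, and `s ≈ M ^ (-1/2)`
gives `12 ‖ν‖₂⁴ M ^ (1/2)` (`expect_ratioInd_mul_diffEnergy_le`). This cell argument takes the place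
of the Szemerédi–Trotter theorem, and it is the only place where the order of the entries is used.

The statement about finite sets is the case of the uniform measure; there the terms
`‖ν‖₂⁶ + ν(0)³` are absorbed since `M(A) ≥ (|A| - 1)²`.
-/

noncomputable section

namespace CommutingPairs

/-! ### Expectations over finitely supported probability measures -/

open Classical in
/-- The indicator of a proposition, as a real number. Classical decidability is built in, so that
indicators of equivalent propositions are interchangeable. -/
def ind (p : Prop) : ℝ := if p then 1 else 0

theorem ind_pos {p : Prop} (h : p) : ind p = 1 := by simp [ind, h]

theorem ind_neg {p : Prop} (h : ¬p) : ind p = 0 := by simp [ind, h]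

theorem ind_nonneg (p : Prop) : 0 ≤ ind p := by
  unfold ind; split_ifs <;> norm_num

theorem ind_mono {p q : Prop} (h : p → q) : ind p ≤ ind q := by
  by_cases hp : p
  · rw [ind_pos hp, ind_pos (h hp)]
  · rw [ind_neg hp]; exact ind_nonneg q

theorem ind_le_one (p : Prop) : ind p ≤ 1 := by
  unfold ind; split_ifs <;> norm_num

theorem ind_and (p q : Prop) : ind (p ∧ q) = ind p * ind q := by
  by_cases hp : p <;> by_cases hq : q <;> simp [ind, hp, hq]

theorem ite_eq_ind (p : Prop) [Decidable p] : (if p then (1 : ℝ) else 0) = ind p := by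
  unfold ind; split_ifs <;> rfl

/-- The expectation of `F` under the finitely supported probability measure `ν`. -/
def expect {α : Type*} (ν : FinProb α) (F : α → ℝ) : ℝ :=
  ∑ x ∈ ν.weights.support, ν.weights x * F x

section expect

variable {α β : Type*} {ν : FinProb α} {ρ : FinProb β} {F G : α → ℝ}

theorem expect_mono (h : ∀ x ∈ ν.weights.support, F x ≤ G x) : expect ν F ≤ expect ν G :=
  Finset.sum_le_sum fun x hx => mul_le_mul_of_nonneg_left (h x hx) (ν.weights_nonneg x)

theorem expect_mono' (h : ∀ x, F x ≤ G x) : expect ν F ≤ expect ν G :=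
  expect_mono fun x _ => h x

theorem expect_nonneg (h : ∀ x, 0 ≤ F x) : 0 ≤ expect ν F :=
  Finset.sum_nonneg fun x _ => mul_nonneg (ν.weights_nonneg x) (h x)

theorem expect_add : expect ν (fun x => F x + G x) = expect ν F + expect ν G := by
  simp only [expect, mul_add, Finset.sum_add_distrib]

theorem expect_const_mul (c : ℝ) : expect ν (fun x => c * F x) = c * expect ν F := by
  simp only [expect, Finset.mul_sum]
  exact Finset.sum_congr rfl fun x _ => by ring

theorem expect_mul_const (c : ℝ) : expect ν (fun x => F x * c) = expect ν F * c := by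
  simp only [expect, Finset.sum_mul]
  exact Finset.sum_congr rfl fun x _ => by ring

theorem expect_const (c : ℝ) : expect ν (fun _ => c) = c := by
  have h : ∑ x ∈ ν.weights.support, ν.weights x = 1 := ν.total
  rw [expect, ← Finset.sum_mul, h, one_mul]

theorem expect_comm (H : α → β → ℝ) :
    expect ν (fun x => expect ρ fun y => H x y) = expect ρ fun y => expect ν fun x => H x y := by
  simp only [expect, Finset.mul_sum]
  rw [Finset.sum_comm]
  exact Finset.sum_congr rfl fun _ _ => Finset.sum_congr rfl fun _ _ => by ring

theorem expect_le (c : ℝ) (h : ∀ x, F x ≤ c) : expect ν F ≤ c :=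
  (expect_mono' h).trans_eq (expect_const c)

theorem expect_ind_eq (a : α) : expect ν (fun x => ind (x = a)) = ν.weights a := by
  classical
  simp only [expect, ind, mul_ite, mul_one, mul_zero, Finset.sum_ite_eq', Finsupp.mem_support_iff]
  split_ifs with h
  · rfl
  · exact (not_not.1 h).symm

end expect

theorem support_productMeasure (ν : FinProb ℝ) :
    (productMeasure ν).weights.support = matricesOver ν.weights.support := by
  ext X
  rw [Finsupp.mem_support_iff, productMeasure_apply, mem_matricesOver]
  simp only [mul_ne_zero_iff, Finsupp.mem_support_iff, Fin.forall_fin_two]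

/-- Expectation under the product measure, as an iterated expectation over the four entries. -/
theorem expect_productMeasure (ν : FinProb ℝ) (F : Mat2 → ℝ) :
    expect (productMeasure ν) F = expect ν fun a => expect ν fun b => expect ν fun c =>
      expect ν fun d => F !![a, b; c, d] := by
  rw [expect, support_productMeasure]
  simp only [expect, Finset.mul_sum]
  simp only [← Finset.sum_product']
  refine Finset.sum_bij' (fun X _ => (X 0 0, X 0 1, X 1 0, X 1 1))
    (fun p _ => !![p.1, p.2.1; p.2.2.1, p.2.2.2]) ?_ ?_ ?_ ?_ ?_
  · intro X hX
    rw [mem_matricesOver] at hX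
    simp only [Finset.mem_product]
    exact ⟨hX _ _, hX _ _, hX _ _, hX _ _⟩
  · rintro ⟨a, b, c, d⟩ h
    simp only [Finset.mem_product] at h
    rw [mem_matricesOver]
    intro i j
    fin_cases i <;> fin_cases j <;> 
      simp only [Matrix.of_apply, Matrix.cons_val', Matrix.cons_val_zero, Matrix.cons_val_one,
        Fin.zero_eta, Fin.mk_one, Matrix.cons_val_fin_one] <;> tauto
  · intro X _
    exact (Matrix.eta_fin_two X).symm
  · rintro ⟨a, b, c, d⟩ _
    simp
  · intro X _
    rw [productMeasure_apply, ← Matrix.eta_fin_two X]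
    ring

theorem T_eq_expect (μ : FinProb Mat2) :
    T μ = expect μ fun X => expect μ fun Y => ind (X * Y = Y * X) := by
  simp only [T, expect, Finset.mul_sum, ite_eq_ind, mul_assoc]

/-- The indicator of the quadruples counted by the multiplicative energy. -/
def ratioInd (p q p' q' : ℝ) : ℝ :=
  ind (p ≠ 0 ∧ q ≠ 0 ∧ p' ≠ 0 ∧ q' ≠ 0 ∧ p / q = p' / q')

theorem sum_support_sdiff_zero (ν : FinProb ℝ) (F : ℝ → ℝ) :
    ∑ x ∈ ν.weights.support \ {0}, ν.weights x * F x =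
      expect ν fun x => ind (x ≠ 0) * F x := by
  rw [expect]
  refine Finset.sum_subset_zero_on_sdiff Finset.sdiff_subset ?_ ?_
  · intro x hx
    have : x = 0 := by simp only [Finset.mem_sdiff, Finset.mem_singleton] at hx; tauto
    rw [ind_neg (by simpa using this), zero_mul, mul_zero]
  · intro x hx
    rw [ind_pos (by simpa using (Finset.mem_sdiff.1 hx).2), one_mul]

theorem multEnergy_eq_expect (ν : FinProb ℝ) :
    multEnergy ν = expect ν fun p => expect ν fun q => expect ν fun p' => expect ν fun q' =>
      ratioInd p q p' q' := by
  simp only [multEnergy, ite_eq_ind, mul_assoc, ← Finset.mul_sum, sum_support_sdiff_zero,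
    ratioInd, ind_and, expect_const_mul]

/-- The squared norm `‖ν‖₂²`. -/
def normSq (ν : FinProb ℝ) : ℝ := ∑ x ∈ ν.weights.support, ν.weights x ^ 2

theorem normSq_nonneg (ν : FinProb ℝ) : 0 ≤ normSq ν := Finset.sum_nonneg fun _ _ => sq_nonneg _

/-- Two independent samples satisfy the relation of a partial injection with probability
at most `‖ν‖₂²`, by the inequality `2xy ≤ x² + y²`. -/
theorem expect_partialInjection_le (ν : FinProb ℝ) (R : ℝ → ℝ → Prop)
    (h₁ : ∀ x y y', R x y → R x y' → y = y') (h₂ : ∀ x x' y, R x y → R x' y → x = x') :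
    expect ν (fun x => expect ν fun y => ind (R x y)) ≤ normSq ν := by
  classical
  have key : ∀ Q : ℝ → ℝ → Prop, (∀ x y y', Q x y → Q x y' → y = y') →
      ∑ x ∈ ν.weights.support, ∑ y ∈ ν.weights.support, ν.weights x ^ 2 * ind (Q x y) ≤
        normSq ν := by
    intro Q hQ
    refine Finset.sum_le_sum fun x _ => ?_
    rw [← Finset.mul_sum]
    refine mul_le_of_le_one_right (sq_nonneg _) ?_
    simp only [ind, Finset.sum_boole]
    norm_cast
    refine Finset.card_le_one.2 fun y hy y' hy' => ?_
    exact hQ x y y' (Finset.mem_filter.1 hy).2 (Finset.mem_filter.1 hy').2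
  have k₁ := key R h₁
  have k₂ := key (fun x y => R y x) fun x y y' h h' => h₂ y y' x h h'
  rw [Finset.sum_comm] at k₂
  have k : 2 * expect ν (fun x => expect ν fun y => ind (R x y)) ≤
      ∑ x ∈ ν.weights.support, ∑ y ∈ ν.weights.support, ν.weights x ^ 2 * ind (R x y) +
      ∑ x ∈ ν.weights.support, ∑ y ∈ ν.weights.support, ν.weights y ^ 2 * ind (R x y) := by
    simp only [expect, Finset.mul_sum, ← Finset.sum_add_distrib]
    refine Finset.sum_le_sum fun x _ => Finset.sum_le_sum fun y _ => ?_
    nlinarith [mul_nonneg (sq_nonneg (ν.weights x - ν.weights y)) (ind_nonneg (R x y))]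
  linarith

/-! ### Splitting a line into cells -/

/-- The pairs of points with equal `τ`, when each fibre of `τ` is cut into `K` parts by `κ`: by
Cauchy–Schwarz at least one pair in `K` lies in a single part. -/
theorem sum_collisions_le {α β : Type*} (P : Finset α) (W : α → ℝ) (τ : α → β) (κ : α → ℕ) (K : ℕ)
    (hκ : ∀ p ∈ P, κ p < K) :
    ∑ p ∈ P, ∑ q ∈ P, W p * W q * ind (τ p = τ q) ≤
      K * ∑ p ∈ P, ∑ q ∈ P, W p * W q * ind (τ p = τ q ∧ κ p = κ q) := by
  classical
  have key : ∀ {γ : Type _} (σ : α → γ) (I : Finset γ), (∀ p ∈ P, σ p ∈ I) →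
      ∑ p ∈ P, ∑ q ∈ P, W p * W q * ind (σ p = σ q) =
        ∑ t ∈ I, (∑ p ∈ P with σ p = t, W p) ^ 2 := by
    intro γ σ I hI
    rw [← Finset.sum_fiberwise_of_maps_to hI]
    refine Finset.sum_congr rfl fun t _ => ?_
    rw [sq, Finset.sum_mul]
    refine Finset.sum_congr rfl fun p hp => ?_
    rw [Finset.mul_sum, Finset.sum_filter]
    refine Finset.sum_congr rfl fun q _ => ?_
    rw [(Finset.mem_filter.1 hp).2]
    by_cases h : σ q = t
    · rw [ind_pos h.symm, if_pos h, mul_one]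
    · rw [ind_neg (Ne.symm h), if_neg h, mul_zero]
  have e₁ := key (γ := β) τ (P.image τ) fun p hp => Finset.mem_image_of_mem τ hp
  have e₂ := key (γ := β × ℕ) (fun p => (τ p, κ p)) (P.image τ ×ˢ Finset.range K) fun p hp =>
    Finset.mem_product.2 ⟨Finset.mem_image_of_mem τ hp, Finset.mem_range.2 (hκ p hp)⟩
  simp only [Prod.mk.injEq] at e₂
  rw [e₁, e₂, Finset.sum_product, Finset.mul_sum]
  refine Finset.sum_le_sum fun t _ => ?_
  have h₁ : ∑ p ∈ P with τ p = t, W p =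
      ∑ k ∈ Finset.range K, ∑ p ∈ P with τ p = t ∧ κ p = k, W p := by
    rw [← Finset.sum_fiberwise_of_maps_to (s := P.filter fun p => τ p = t) (g := κ)
      (t := Finset.range K) fun p hp => Finset.mem_range.2 (hκ p (Finset.mem_filter.1 hp).1)]
    simp only [Finset.filter_filter]
  rw [h₁]
  simpa using sq_sum_le_card_mul_sum_sq (s := Finset.range K)
    (f := fun k => ∑ p ∈ P with τ p = t ∧ κ p = k, W p)

/-- The mass of the half-line `(-∞, x)`. -/
def massBelow (ν : FinProb ℝ) (x : ℝ) : ℝ := ∑ y ∈ ν.weights.support with y < x, ν.weights y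

theorem massBelow_nonneg (ν : FinProb ℝ) (x : ℝ) : 0 ≤ massBelow ν x :=
  Finset.sum_nonneg fun y _ => ν.weights_nonneg y

theorem massBelow_mono (ν : FinProb ℝ) : Monotone (massBelow ν) := fun _ _ hxy =>
  Finset.sum_le_sum_of_subset_of_nonneg
    (Finset.monotone_filter_right _ fun _ _ h => h.trans_le hxy) fun y _ _ => ν.weights_nonneg y

theorem massBelow_lt_one (ν : FinProb ℝ) {x : ℝ} (hx : x ∈ ν.weights.support) :
    massBelow ν x < 1 := by
  have h : ∑ x ∈ ν.weights.support, ν.weights x = 1 := ν.total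
  rw [← h]
  refine Finset.sum_lt_sum_of_subset (Finset.filter_subset _ _) hx (by simp) ?_
    fun y _ _ => ν.weights_nonneg y
  exact lt_of_le_of_ne (ν.weights_nonneg x) (Finsupp.mem_support_iff.1 hx).symm

/-- The index of the interval containing `x`, when the line is cut into `s` intervals at the
multiples of `1 / s` of the distribution function of `ν`. Using the mass strictly below `x` makes
a heavy atom end its interval, so atoms need no separate treatment. -/
def cell (ν : FinProb ℝ) (s : ℕ) (x : ℝ) : ℕ := ⌊s * massBelow ν x⌋₊

theorem cell_mono (ν : FinProb ℝ) (s : ℕ) : Monotone (cell ν s) := fun _ _ hxy =>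
  Nat.floor_mono (mul_le_mul_of_nonneg_left (massBelow_mono ν hxy) s.cast_nonneg)

theorem cell_lt (ν : FinProb ℝ) {s : ℕ} (hs : 0 < s) {x : ℝ} (hx : x ∈ ν.weights.support) :
    cell ν s x < s := by
  have hs' : (0 : ℝ) < s := by exact_mod_cast hs
  rw [cell, Nat.floor_lt (mul_nonneg hs'.le (massBelow_nonneg ν x))]
  exact mul_lt_of_lt_one_right hs' (massBelow_lt_one ν hx)

/-- The part of the cell of `x` to the left of `x` has mass at most `1 / s`. -/
theorem expect_cell_left_le (ν : FinProb ℝ) {s : ℕ} (hs : 0 < s) (x : ℝ) :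
    expect ν (fun y => ind (y < x ∧ cell ν s y = cell ν s x)) ≤ 1 / s := by
  classical
  have hs' : (0 : ℝ) < s := by exact_mod_cast hs
  set B := ν.weights.support.filter fun y => y < x ∧ cell ν s y = cell ν s x with hB
  have e : expect ν (fun y => ind (y < x ∧ cell ν s y = cell ν s x)) = ∑ y ∈ B, ν.weights y := by
    rw [hB, Finset.sum_filter]
    refine Finset.sum_congr rfl fun y _ => ?_
    dsimp only
    by_cases h : y < x ∧ cell ν s y = cell ν s x
    · rw [ind_pos h, if_pos h, mul_one]
    · rw [ind_neg h, if_neg h, mul_zero]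
  rw [e]
  rcases B.eq_empty_or_nonempty with h | h
  · rw [h, Finset.sum_empty]; positivity
  · -- Everything in `B` lies between its minimum and `x`, so its mass is an increment of the
    -- distribution function inside one cell.
    set y₀ := B.min' h
    have hy₀ : y₀ ∈ B := B.min'_mem h
    obtain ⟨_, hlt, hc⟩ := Finset.mem_filter.1 hy₀
    have h₁ : ∑ y ∈ B, ν.weights y + massBelow ν y₀ ≤ massBelow ν x := by
      have hd : Disjoint B (ν.weights.support.filter fun y => y < y₀) := by
        rw [Finset.disjoint_left]
        intro y hy hy'
        exact absurd (Finset.mem_filter.1 hy').2 (not_lt.2 (B.min'_le y hy))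
      rw [massBelow, ← Finset.sum_union hd]
      refine Finset.sum_le_sum_of_subset_of_nonneg ?_ fun y _ _ => ν.weights_nonneg y
      intro y hy
      rcases Finset.mem_union.1 hy with hy | hy
      · exact Finset.mem_filter.2 ⟨(Finset.mem_filter.1 hy).1, (Finset.mem_filter.1 hy).2.1⟩
      · exact Finset.mem_filter.2
          ⟨(Finset.mem_filter.1 hy).1, (Finset.mem_filter.1 hy).2.trans hlt⟩
    have h₂ : s * massBelow ν x < cell ν s x + 1 := Nat.lt_floor_add_one _
    have h₃ : (cell ν s y₀ : ℝ) ≤ s * massBelow ν y₀ :=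
      Nat.floor_le (mul_nonneg hs'.le (massBelow_nonneg ν y₀))
    rw [hc] at h₃
    rw [le_div_iff₀ hs']
    nlinarith [mul_le_mul_of_nonneg_left h₁ hs'.le]

/-- `x` and `y` are distinct points of one cell. -/
def SameCell (ν : FinProb ℝ) (s : ℕ) (x y : ℝ) : Prop := x ≠ y ∧ cell ν s x = cell ν s y

theorem expect_sameCell_le (ν : FinProb ℝ) {s : ℕ} (hs : 0 < s) :
    expect ν (fun x => expect ν fun y => ind (SameCell ν s x y)) ≤ 2 / s := by
  have h : ∀ x y, ind (SameCell ν s x y) ≤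
      ind (y < x ∧ cell ν s y = cell ν s x) + ind (x < y ∧ cell ν s x = cell ν s y) := by
    intro x y
    by_cases hxy : SameCell ν s x y
    · rw [ind_pos hxy]
      rcases lt_or_gt_of_ne hxy.1 with h | h
      · rw [ind_pos (p := x < y ∧ _) ⟨h, hxy.2⟩]
        linarith [ind_nonneg (y < x ∧ cell ν s y = cell ν s x)]
      · rw [ind_pos (p := y < x ∧ _) ⟨h, hxy.2.symm⟩]
        linarith [ind_nonneg (x < y ∧ cell ν s x = cell ν s y)]
    · rw [ind_neg hxy]
      exact add_nonneg (ind_nonneg _) (ind_nonneg _)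
  refine (expect_mono' fun x => expect_mono' (h x)).trans ?_
  simp only [expect_add]
  rw [expect_comm fun x y => ind (x < y ∧ cell ν s x = cell ν s y)]
  have h' := expect_le (ν := ν) _ fun x => expect_cell_left_le ν hs x
  calc _ ≤ 1 / (s : ℝ) + 1 / s := add_le_add h' h'
    _ = 2 / s := by ring

/-! ### Pairs of differences with a given ratio -/

/-- The probability that two differences of independent samples have ratio `r`, a degenerate pair
of differences `0, 0` being counted for every `r`. -/
def diffEnergy (ν : FinProb ℝ) (r : ℝ) : ℝ :=
  expect ν fun x => expect ν fun y => expect ν fun u => expect ν fun v => ind (x - y = r * (u - v))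

/-- The part of `diffEnergy` in which both differences are nonzero and have their two terms in a
common cell. -/
def localEnergy (ν : FinProb ℝ) (s : ℕ) (r : ℝ) : ℝ :=
  expect ν fun x => expect ν fun y => expect ν fun u => expect ν fun v =>
    ind (SameCell ν s x y ∧ SameCell ν s u v ∧ x - y = r * (u - v))

/-- Exchanging `u` and `v` changes the sign of `u - v`, hence of `r`. -/
theorem diffEnergy_neg (ν : FinProb ℝ) (r : ℝ) : diffEnergy ν (-r) = diffEnergy ν r := by
  unfold diffEnergy
  congr! 4 with x y
  rw [expect_comm]
  congr! 6 with v u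
  rw [neg_mul, ← mul_neg, neg_sub]

theorem sameCell_comm {ν : FinProb ℝ} {s : ℕ} {x y : ℝ} : SameCell ν s x y ↔ SameCell ν s y x := by
  unfold SameCell
  rw [ne_comm, eq_comm (a := cell ν s x)]

theorem localEnergy_neg (ν : FinProb ℝ) (s : ℕ) (r : ℝ) :
    localEnergy ν s (-r) = localEnergy ν s r := by
  unfold localEnergy
  congr! 4 with x y
  rw [expect_comm]
  congr! 4 with v u
  rw [sameCell_comm (x := u), neg_mul, ← mul_neg, neg_sub]

theorem expect_eq_self (ν : FinProb ℝ) :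
    expect ν (fun x => expect ν fun y => ind (x = y)) = normSq ν := by
  rw [normSq, expect]
  refine Finset.sum_congr rfl fun x _ => ?_
  simp only [eq_comm (a := x)]
  rw [expect_ind_eq, sq]

/-- A line of positive slope `r` meets the grid of cells in a chain, on which the sum of the two
cell indices is injective. -/
theorem diffEnergy_le_of_pos (ν : FinProb ℝ) {s : ℕ} (hs : 0 < s) {r : ℝ} (hr : 0 < r) :
    diffEnergy ν r ≤ 2 * s * (normSq ν ^ 2 + localEnergy ν s r) := by
  have swap : ∀ H : ℝ → ℝ → ℝ → ℝ → Prop,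
      (expect ν fun x => expect ν fun y => expect ν fun u => expect ν fun v => ind (H x y u v)) =
      ∑ p ∈ ν.weights.support ×ˢ ν.weights.support, ∑ q ∈ ν.weights.support ×ˢ ν.weights.support,
        ν.weights p.1 * ν.weights p.2 * (ν.weights q.1 * ν.weights q.2) *
          ind (H p.1 q.1 p.2 q.2) := by
    intro H
    have : ∀ x, (expect ν fun y => expect ν fun u => expect ν fun v => ind (H x y u v)) =
      expect ν fun u => expect ν fun y => expect ν fun v => ind (H x y u v) :=
      fun x => expect_comm _
    simp only [this]
    simp only [Finset.sum_product, expect, Finset.mul_sum, mul_assoc]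
  have h₁ := sum_collisions_le (ν.weights.support ×ˢ ν.weights.support)
    (fun p => ν.weights p.1 * ν.weights p.2) (fun p => p.1 - r * p.2)
    (fun p => cell ν s p.1 + cell ν s p.2)
    (2 * s) (by
      intro p hp
      have := cell_lt ν hs (Finset.mem_product.1 hp).1
      have := cell_lt ν hs (Finset.mem_product.1 hp).2
      omega)
  rw [← swap fun x y u v => x - r * u = y - r * v,
    ← swap fun x y u v =>
      x - r * u = y - r * v ∧ cell ν s x + cell ν s u = cell ν s y + cell ν s v] at h₁
  have h₂ : ∀ x y u v : ℝ,
      ind (x - r * u = y - r * v ∧ cell ν s x + cell ν s u = cell ν s y + cell ν s v) ≤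
      ind (x = y) * ind (u = v) +
        ind (SameCell ν s x y ∧ SameCell ν s u v ∧ x - y = r * (u - v)) := by
    intro x y u v
    rw [← ind_and]
    by_cases h : x - r * u = y - r * v ∧ cell ν s x + cell ν s u = cell ν s y + cell ν s v
    swap
    · rw [ind_neg h]
      exact add_nonneg (ind_nonneg _) (ind_nonneg _)
    rw [ind_pos h]
    obtain ⟨h, hk⟩ := h
    have hd : x - y = r * (u - v) := by linarith
    rcases lt_trichotomy u v with huv | huv | huv
    · have hxy : x < y := by nlinarith
      have m₁ : cell ν s x ≤ cell ν s y := cell_mono ν s hxy.le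
      have m₂ : cell ν s u ≤ cell ν s v := cell_mono ν s huv.le
      rw [ind_pos (p := SameCell ν s x y ∧ _)
        ⟨⟨hxy.ne, by omega⟩, ⟨huv.ne, by omega⟩, hd⟩]
      linarith [ind_nonneg (x = y ∧ u = v)]
    · have hxy : x = y := by rw [huv] at hd; linarith
      rw [ind_pos ⟨hxy, huv⟩]
      linarith [ind_nonneg (SameCell ν s x y ∧ SameCell ν s u v ∧ x - y = r * (u - v))]
    · have hxy : y < x := by nlinarith
      have m₁ : cell ν s y ≤ cell ν s x := cell_mono ν s hxy.le
      have m₂ : cell ν s v ≤ cell ν s u := cell_mono ν s huv.le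
      rw [ind_pos (p := SameCell ν s x y ∧ _)
        ⟨⟨hxy.ne', by omega⟩, ⟨huv.ne', by omega⟩, hd⟩]
      linarith [ind_nonneg (x = y ∧ u = v)]
  have h₃ := expect_mono' (ν := ν) fun x => expect_mono' (ν := ν) fun y =>
    expect_mono' (ν := ν) fun u => expect_mono' (ν := ν) fun v => h₂ x y u v
  simp only [expect_add, expect_const_mul, expect_mul_const, expect_eq_self] at h₃
  have h₄ : ∀ x y u v : ℝ, (x - y = r * (u - v)) = (x - r * u = y - r * v) := fun x y u v =>
    propext ⟨fun h => by linarith, fun h => by linarith⟩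
  rw [diffEnergy]
  simp only [h₄]
  refine h₁.trans ?_
  push_cast
  refine mul_le_mul_of_nonneg_left (h₃.trans_eq ?_) (by positivity)
  rw [localEnergy, sq]

theorem diffEnergy_le (ν : FinProb ℝ) {s : ℕ} (hs : 0 < s) {r : ℝ} (hr : r ≠ 0) :
    diffEnergy ν r ≤ 2 * s * (normSq ν ^ 2 + localEnergy ν s r) := by
  rcases lt_or_gt_of_ne hr with h | h
  · rw [← diffEnergy_neg, ← localEnergy_neg]
    exact diffEnergy_le_of_pos ν hs (neg_pos.2 h)
  · exact diffEnergy_le_of_pos ν hs h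

/-! ### Rearranging iterated expectations -/

section rearrange

variable (ν : FinProb ℝ)

theorem expect_congr {F G : ℝ → ℝ} (h : ∀ x, F x = G x) : expect ν F = expect ν G := by
  rw [funext h]

theorem expect_comm₂ (F : ℝ → ℝ → ℝ → ℝ) :
    (expect ν fun a => expect ν fun b => expect ν fun c => F a b c) =
      expect ν fun b => expect ν fun c => expect ν fun a => F a b c :=
  (expect_comm _).trans (expect_congr ν fun _ => expect_comm _)

theorem expect₂_comm₂ (F : ℝ → ℝ → ℝ → ℝ → ℝ) :
    (expect ν fun a => expect ν fun b => expect ν fun c => expect ν fun d => F a b c d) =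
      expect ν fun c => expect ν fun d => expect ν fun a => expect ν fun b => F a b c d :=
  (expect_congr ν fun a => expect_comm₂ ν (F a)).trans
    (expect_comm₂ ν fun a c d => expect ν fun b => F a b c d)

theorem expect_comm₄ (F : ℝ → ℝ → ℝ → ℝ → ℝ → ℝ) :
    (expect ν fun p => expect ν fun a => expect ν fun b => expect ν fun c => expect ν fun d =>
        F p a b c d) =
      expect ν fun a => expect ν fun b => expect ν fun c => expect ν fun d => expect ν fun p =>
        F p a b c d :=
  (expect_comm₂ ν fun p a b => expect ν fun c => expect ν fun d => F p a b c d).trans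
    (expect_congr ν fun _ => expect_congr ν fun _ => expect_comm₂ ν _)

theorem expect₄_comm₄ (F : ℝ → ℝ → ℝ → ℝ → ℝ → ℝ → ℝ → ℝ → ℝ) :
    (expect ν fun p => expect ν fun q => expect ν fun p' => expect ν fun q' =>
      expect ν fun x => expect ν fun y => expect ν fun u => expect ν fun v =>
        F p q p' q' x y u v) =
    expect ν fun x => expect ν fun y => expect ν fun u => expect ν fun v =>
      expect ν fun p => expect ν fun q => expect ν fun p' => expect ν fun q' =>
        F p q p' q' x y u v :=
  calc
    _ = expect ν fun p => expect ν fun q => expect ν fun p' =>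
          expect ν fun x => expect ν fun y => expect ν fun u => expect ν fun v =>
            expect ν fun q' => F p q p' q' x y u v :=
        expect_congr ν fun p => expect_congr ν fun q => expect_congr ν fun p' =>
          expect_comm₄ ν (F p q p')
    _ = expect ν fun p => expect ν fun q =>
          expect ν fun x => expect ν fun y => expect ν fun u => expect ν fun v =>
            expect ν fun p' => expect ν fun q' => F p q p' q' x y u v :=
        expect_congr ν fun p => expect_congr ν fun q => expect_comm₄ ν fun p' x y u v =>
          expect ν fun q' => F p q p' q' x y u v
    _ = expect ν fun p =>
          expect ν fun x => expect ν fun y => expect ν fun u => expect ν fun v =>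
            expect ν fun q => expect ν fun p' => expect ν fun q' => F p q p' q' x y u v :=
        expect_congr ν fun p => expect_comm₄ ν fun q x y u v =>
          expect ν fun p' => expect ν fun q' => F p q p' q' x y u v
    _ = _ := expect_comm₄ ν fun p x y u v =>
          expect ν fun q => expect ν fun p' => expect ν fun q' => F p q p' q' x y u v

/-- Two matrices with independent entries, regrouped so that the off-diagonal entries come first,
in corresponding pairs, followed by the two diagonals. -/
theorem expect_regroup (F : ℝ → ℝ → ℝ → ℝ → ℝ → ℝ → ℝ → ℝ → ℝ) :
    (expect ν fun x => expect ν fun p => expect ν fun p' => expect ν fun y =>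
      expect ν fun u => expect ν fun q => expect ν fun q' => expect ν fun v =>
        F p q p' q' x y u v) =
    expect ν fun p => expect ν fun q => expect ν fun p' => expect ν fun q' =>
      expect ν fun x => expect ν fun y => expect ν fun u => expect ν fun v =>
        F p q p' q' x y u v :=
  calc
    _ = expect ν fun p => expect ν fun p' => expect ν fun x => expect ν fun y =>
          expect ν fun u => expect ν fun q => expect ν fun q' => expect ν fun v =>
            F p q p' q' x y u v := expect_comm₂ ν _
    _ = expect ν fun p => expect ν fun p' => expect ν fun x => expect ν fun y =>
          expect ν fun q => expect ν fun q' => expect ν fun u => expect ν fun v =>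
            F p q p' q' x y u v :=
        expect_congr ν fun _ => expect_congr ν fun _ => expect_congr ν fun _ =>
          expect_congr ν fun _ => expect_comm₂ ν _
    _ = expect ν fun p => expect ν fun p' => expect ν fun q => expect ν fun q' =>
          expect ν fun x => expect ν fun y => expect ν fun u => expect ν fun v =>
            F p q p' q' x y u v :=
        expect_congr ν fun p => expect_congr ν fun p' => expect₂_comm₂ ν fun x y q q' =>
          expect ν fun u => expect ν fun v => F p q p' q' x y u v
    _ = _ := expect_congr ν fun _ => expect_comm _

end rearrange

/-! ### Commuting pairs without zero off-diagonal entries -/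

theorem expect_eq_mul_le (ν : FinProb ℝ) {c : ℝ} (hc : c ≠ 0) :
    expect ν (fun p => expect ν fun q => ind (p = c * q)) ≤ normSq ν :=
  expect_partialInjection_le ν _ (fun _ _ _ h h' => mul_left_cancel₀ hc (h.symm.trans h'))
    fun _ _ _ h h' => h.trans h'.symm

/-- Given the two differences, their ratio `c` is fixed, so both quotients counted by the
multiplicative energy equal `c`; each does so with probability at most `‖ν‖₂²`. -/
theorem expect_ratioInd_mul_localEnergy_le (ν : FinProb ℝ) {s : ℕ} (hs : 0 < s) :
    (expect ν fun p => expect ν fun q => expect ν fun p' => expect ν fun q' =>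
      ratioInd p q p' q' * localEnergy ν s (p / q)) ≤ (2 / s) ^ 2 * normSq ν ^ 2 := by
  simp only [localEnergy, ← expect_const_mul]
  rw [expect₄_comm₄]
  have h : ∀ x y u v : ℝ, (expect ν fun p => expect ν fun q => expect ν fun p' =>
      expect ν fun q' => ratioInd p q p' q' *
        ind (SameCell ν s x y ∧ SameCell ν s u v ∧ x - y = p / q * (u - v))) ≤
      ind (SameCell ν s x y) * (ind (SameCell ν s u v) * normSq ν ^ 2) := by
    intro x y u v
    by_cases hxy : SameCell ν s x y
    swap
    · simp only [hxy, false_and, ind_neg (not_false), mul_zero, zero_mul, expect_const,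
        le_refl]
    by_cases huv : SameCell ν s u v
    swap
    · simp only [huv, false_and, and_false, ind_neg (not_false), mul_zero, zero_mul,
        expect_const, le_refl]
    simp only [ind_pos hxy, ind_pos huv, one_mul]
    have hx : x - y ≠ 0 := sub_ne_zero.2 hxy.1
    have hu : u - v ≠ 0 := sub_ne_zero.2 huv.1
    set c := (x - y) / (u - v)
    have hc : c ≠ 0 := div_ne_zero hx hu
    have hpt : ∀ p q p' q' : ℝ, ratioInd p q p' q' *
        ind (SameCell ν s x y ∧ SameCell ν s u v ∧ x - y = p / q * (u - v)) ≤
        ind (p = c * q) * ind (p' = c * q') := by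
      intro p q p' q'
      rw [ratioInd, ← ind_and, ← ind_and]
      refine ind_mono ?_
      rintro ⟨⟨_, hq, _, hq', e⟩, _, _, e'⟩
      have hcq : c = p / q := by rw [div_eq_iff hu, e']
      exact ⟨by rw [hcq, div_mul_cancel₀ _ hq], by rw [hcq, e, div_mul_cancel₀ _ hq']⟩
    refine (expect_mono' fun p => expect_mono' fun q => expect_mono' fun p' =>
      expect_mono' fun q' => hpt p q p' q').trans ?_
    simp only [expect_const_mul, expect_mul_const]
    rw [sq]
    exact mul_le_mul (expect_eq_mul_le ν hc) (expect_eq_mul_le ν hc)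
      (expect_nonneg fun _ => expect_nonneg fun _ => ind_nonneg _) (normSq_nonneg ν)
  refine (expect_mono' fun x => expect_mono' fun y => expect_mono' fun u =>
      expect_mono' fun v => h x y u v).trans ?_
  simp only [expect_const_mul, expect_mul_const]
  have hS := expect_sameCell_le ν hs
  have hS₀ : 0 ≤ expect ν (fun x => expect ν fun y => ind (SameCell ν s x y)) :=
    expect_nonneg fun _ => expect_nonneg fun _ => ind_nonneg _
  rw [← mul_assoc, ← sq]
  exact mul_le_mul_of_nonneg_right (pow_le_pow_left₀ hS₀ hS 2) (sq_nonneg _)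

theorem multEnergy_nonneg (ν : FinProb ℝ) : 0 ≤ multEnergy ν := by
  rw [multEnergy_eq_expect]
  exact expect_nonneg fun _ => expect_nonneg fun _ => expect_nonneg fun _ => expect_nonneg fun _ =>
    ind_nonneg _

theorem multEnergy_le_one (ν : FinProb ℝ) : multEnergy ν ≤ 1 := by
  rw [multEnergy_eq_expect]
  exact expect_le _ fun _ => expect_le _ fun _ => expect_le _ fun _ => expect_le _ fun _ =>
    ind_le_one _

theorem diffEnergy_le_one (ν : FinProb ℝ) (r : ℝ) : diffEnergy ν r ≤ 1 :=
  expect_le _ fun _ => expect_le _ fun _ => expect_le _ fun _ => expect_le _ fun _ => ind_le_one _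

theorem expect_ratioInd_mul_diffEnergy_le_of_cells (ν : FinProb ℝ) {s : ℕ} (hs : 0 < s) :
    (expect ν fun p => expect ν fun q => expect ν fun p' => expect ν fun q' =>
      ratioInd p q p' q' * diffEnergy ν (p / q)) ≤
      2 * s * (multEnergy ν * normSq ν ^ 2 + (2 / s) ^ 2 * normSq ν ^ 2) := by
  have hpt : ∀ p q p' q' : ℝ, ratioInd p q p' q' * diffEnergy ν (p / q) ≤
      2 * s * (ratioInd p q p' q' * normSq ν ^ 2 +
        ratioInd p q p' q' * localEnergy ν s (p / q)) := by
    intro p q p' q'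
    by_cases h : p ≠ 0 ∧ q ≠ 0 ∧ p' ≠ 0 ∧ q' ≠ 0 ∧ p / q = p' / q'
    · rw [ratioInd, ind_pos h, one_mul, one_mul, one_mul]
      exact diffEnergy_le ν hs (div_ne_zero h.1 h.2.1)
    · rw [ratioInd, ind_neg h]
      simp
  refine (expect_mono' fun p => expect_mono' fun q => expect_mono' fun p' =>
      expect_mono' fun q' => hpt p q p' q').trans ?_
  simp only [expect_const_mul, expect_add, expect_mul_const]
  rw [← multEnergy_eq_expect]
  have := expect_ratioInd_mul_localEnergy_le ν hs
  simp only [expect_mul_const] at this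
  gcongr

/-- The number of cells is chosen to balance the two terms of
`expect_ratioInd_mul_diffEnergy_le_of_cells`. -/
theorem expect_ratioInd_mul_diffEnergy_le (ν : FinProb ℝ) :
    (expect ν fun p => expect ν fun q => expect ν fun p' => expect ν fun q' =>
      ratioInd p q p' q' * diffEnergy ν (p / q)) ≤ 12 * (normSq ν ^ 2 * √(multEnergy ν)) := by
  rcases (multEnergy_nonneg ν).eq_or_lt with h0 | h0
  · have h : (expect ν fun p => expect ν fun q => expect ν fun p' => expect ν fun q' =>
        ratioInd p q p' q' * diffEnergy ν (p / q)) ≤ multEnergy ν := by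
      rw [multEnergy_eq_expect]
      exact expect_mono' fun _ => expect_mono' fun _ => expect_mono' fun _ => expect_mono' fun _ =>
        mul_le_of_le_one_right (ind_nonneg _) (diffEnergy_le_one ν _)
    refine h.trans ?_
    rw [← h0, Real.sqrt_zero, mul_zero, mul_zero]
  · set m := √(multEnergy ν) with hm
    have hm0 : 0 < m := Real.sqrt_pos.2 h0
    have hmm : multEnergy ν = m ^ 2 := (Real.sq_sqrt h0.le).symm
    have hm1 : m ≤ 1 := Real.sqrt_le_one.2 (multEnergy_le_one ν)
    set s := ⌈1 / m⌉₊ with hsdef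
    have hs : 0 < s := Nat.ceil_pos.2 (by positivity)
    have hs' : (0 : ℝ) < s := by exact_mod_cast hs
    have h₁ : 1 ≤ s * m := by
      rw [← div_le_iff₀ hm0]; exact Nat.le_ceil _
    have h₂ : s * m ≤ 2 := by
      have h := (Nat.ceil_lt_add_one (a := 1 / m) (by positivity)).le
      calc s * m ≤ (1 / m + 1) * m := mul_le_mul_of_nonneg_right h hm0.le
        _ = 1 + m := by field_simp
        _ ≤ 2 := by linarith
    have h₃ : 1 / (s : ℝ) ≤ m := by rw [div_le_iff₀ hs']; linarith
    refine (expect_ratioInd_mul_diffEnergy_le_of_cells ν hs).trans ?_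
    rw [hmm]
    calc 2 * s * (m ^ 2 * normSq ν ^ 2 + (2 / s) ^ 2 * normSq ν ^ 2)
        = (2 * (s * m) * m + 8 * (1 / s)) * normSq ν ^ 2 := by field_simp; ring
      _ ≤ (2 * 2 * m + 8 * m) * normSq ν ^ 2 := by gcongr
      _ = 12 * (normSq ν ^ 2 * m) := by ring

/-! ### Commuting pairs with zero off-diagonal entries -/

/-- The conditions for `!![x, p; p', y]` and `!![u, q; q', v]` to commute: the vectors
`(p, p', x - y)` and `(q, q', u - v)` are parallel. -/
def Parallel (p q p' q' x y u v : ℝ) : Prop :=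
  p * q' = q * p' ∧ p * (u - v) = q * (x - y) ∧ p' * (u - v) = q' * (x - y)

theorem parallel_of_commute {p q p' q' x y u v : ℝ}
    (h : (!![x, p; p', y] : Mat2) * !![u, q; q', v] = !![u, q; q', v] * !![x, p; p', y]) :
    Parallel p q p' q' x y u v := by
  simp only [Matrix.mul_fin_two] at h
  have h₀₀ := congrFun (congrFun h 0) 0
  have h₀₁ := congrFun (congrFun h 0) 1
  have h₁₀ := congrFun (congrFun h 1) 0
  simp at h₀₀ h₀₁ h₁₀
  exact ⟨by linarith, by linarith, by linarith⟩

/-- A nontrivial linear equation between the differences of the diagonal entries determines one of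
the differences from the other, and so one entry from the other three. -/
theorem expect_linear_le (ν : FinProb ℝ) {p q : ℝ} (h : ¬(p = 0 ∧ q = 0)) :
    (expect ν fun x => expect ν fun y => expect ν fun u => expect ν fun v =>
      ind (p * (u - v) = q * (x - y))) ≤ normSq ν := by
  by_cases hp : p = 0
  · have hq : q ≠ 0 := fun hq => h ⟨hp, hq⟩
    rw [expect₂_comm₂]
    refine expect_le _ fun u => expect_le _ fun v => expect_partialInjection_le ν _ ?_ ?_
    · intro x y y' e e'
      linarith [mul_left_cancel₀ hq (e.symm.trans e')]
    · intro x x' y e e'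
      linarith [mul_left_cancel₀ hq (e.symm.trans e')]
  · refine expect_le _ fun u => expect_le _ fun v => expect_partialInjection_le ν _ ?_ ?_
    · intro x y y' e e'
      linarith [mul_left_cancel₀ hp (e.trans e'.symm)]
    · intro x x' y e e'
      linarith [mul_left_cancel₀ hp (e.trans e'.symm)]

/-- For given off-diagonal entries, the probability that the diagonals make the matrices commute:
the first term is the case of four nonzero entries. If some entry is zero, `p * q' = q * p'` leaves
one of the four pairs of the second term equal to zero, and unless all four entries are zero the
diagonals satisfy a nontrivial linear equation. -/
theorem expect_parallel_le (ν : FinProb ℝ) (p q p' q' : ℝ) :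
    (expect ν fun x => expect ν fun y => expect ν fun u => expect ν fun v =>
      ind (Parallel p q p' q' x y u v)) ≤
    ratioInd p q p' q' * diffEnergy ν (p / q) +
      normSq ν * (ind (p = 0) * ind (q = 0) + ind (p' = 0) * ind (q' = 0) +
        ind (p = 0) * ind (p' = 0) + ind (q = 0) * ind (q' = 0)) +
      ind (p = 0) * (ind (q = 0) * (ind (p' = 0) * ind (q' = 0))) := by
  set D := expect ν fun x => expect ν fun y => expect ν fun u => expect ν fun v =>
      ind (Parallel p q p' q' x y u v)
  have hN := normSq_nonneg ν
  have hR : 0 ≤ ratioInd p q p' q' * diffEnergy ν (p / q) :=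
    mul_nonneg (ind_nonneg _) (expect_nonneg fun _ => expect_nonneg fun _ => expect_nonneg fun _ =>
      expect_nonneg fun _ => ind_nonneg _)
  have D_le_one : D ≤ 1 := expect_le _ fun _ => expect_le _ fun _ => expect_le _ fun _ =>
    expect_le _ fun _ => ind_le_one _
  have D_le : ¬(p = 0 ∧ q = 0) → D ≤ normSq ν := fun h =>
    (expect_mono' fun _ => expect_mono' fun _ => expect_mono' fun _ => expect_mono' fun _ =>
      ind_mono fun h' => h'.2.1).trans (expect_linear_le ν h)
  have D_le' : ¬(p' = 0 ∧ q' = 0) → D ≤ normSq ν := fun h =>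
    (expect_mono' fun _ => expect_mono' fun _ => expect_mono' fun _ => expect_mono' fun _ =>
      ind_mono fun h' => h'.2.2).trans (expect_linear_le ν h)
  have D_zero : p * q' ≠ q * p' → D ≤ 0 := fun h =>
    expect_le _ fun _ => expect_le _ fun _ => expect_le _ fun _ => expect_le _ fun _ =>
      (ind_neg fun h' => h h'.1).le
  by_cases hne : p ≠ 0 ∧ q ≠ 0 ∧ p' ≠ 0 ∧ q' ≠ 0
  · obtain ⟨hp, hq, hp', hq'⟩ := hne
    have hD : D ≤ ratioInd p q p' q' * diffEnergy ν (p / q) := by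
      by_cases h : p * q' = q * p'
      · rw [ratioInd, ind_pos ⟨hp, hq, hp', hq', by rw [div_eq_div_iff hq hq']; linarith⟩, one_mul]
        refine expect_mono' fun _ => expect_mono' fun _ => expect_mono' fun _ =>
          expect_mono' fun _ => ind_mono fun h' => ?_
        rw [div_mul_eq_mul_div, eq_div_iff hq]
        linarith [h'.2.1]
      · exact (D_zero h).trans hR
    simpa [ind_neg hp, ind_neg hq, ind_neg hp', ind_neg hq'] using hD
  · generalize ratioInd p q p' q' * diffEnergy ν (p / q) = R at hR ⊢
    clear_value D
    have i₁ : ind True = 1 := ind_pos trivial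
    have i₀ : ind False = 0 := ind_neg not_false
    by_cases hp : p = 0 <;> by_cases hq : q = 0 <;> by_cases hp' : p' = 0 <;>
      by_cases hq' : q' = 0 <;> simp [hp, hq, hp', hq', i₁, i₀] at * <;> linarith

theorem weights_le_one (ν : FinProb ℝ) (x : ℝ) : ν.weights x ≤ 1 := by
  rw [← expect_ind_eq]
  exact expect_le _ fun _ => ind_le_one _

/-- The bound for measures, in terms of `‖ν‖₂²`. The term `‖ν‖_∞² M(ν)` is not needed. -/
theorem T_productMeasure_le (ν : FinProb ℝ) :
    T (productMeasure ν) ≤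
      12 * (normSq ν ^ 2 * √(multEnergy ν) + normSq ν ^ 3 + ν.weights 0 ^ 3) := by
  set z := ν.weights 0 with hz
  have hz0 : 0 ≤ z := ν.weights_nonneg 0
  have hz1 : z ≤ 1 := weights_le_one ν 0
  have hN := normSq_nonneg ν
  have h₁ : T (productMeasure ν) ≤ expect ν fun p => expect ν fun q => expect ν fun p' =>
      expect ν fun q' => expect ν fun x => expect ν fun y => expect ν fun u => expect ν fun v =>
        ind (Parallel p q p' q' x y u v) := by
    rw [T_eq_expect, ← expect_regroup, expect_productMeasure]
    simp only [expect_productMeasure]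
    exact expect_mono' fun _ => expect_mono' fun _ => expect_mono' fun _ => expect_mono' fun _ =>
      expect_mono' fun _ => expect_mono' fun _ => expect_mono' fun _ => expect_mono' fun _ =>
        ind_mono parallel_of_commute
  have h₂ := h₁.trans (expect_mono' fun p => expect_mono' fun q => expect_mono' fun p' =>
    expect_mono' fun q' => expect_parallel_le ν p q p' q')
  simp only [expect_add, expect_const_mul, expect_mul_const, expect_const, expect_ind_eq,
    ← hz] at h₂
  have h₃ := expect_ratioInd_mul_diffEnergy_le ν
  simp only [expect_mul_const] at h₃
  have h₄ : z ^ 2 * normSq ν ≤ normSq ν ^ 3 + z ^ 3 := by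
    rcases le_total z (normSq ν) with h | h
    · nlinarith [pow_le_pow_left₀ hz0 h 2, pow_nonneg hz0 3]
    · nlinarith [mul_le_mul_of_nonneg_left h (sq_nonneg z), pow_nonneg hN 3]
  have h₅ : z ^ 4 ≤ z ^ 3 := pow_le_pow_of_le_one hz0 hz1 (by norm_num)
  nlinarith [pow_nonneg hz0 3, pow_nonneg hN 3]

/-! ### Norms, and the uniform measure on a finite set -/

theorem lpNorm_two_sq (ν : FinProb ℝ) : lpNorm 2 ν ^ 2 = normSq ν := by
  have h : ∑ x ∈ ν.weights.support, ν.weights x ^ (2 : ℝ) = normSq ν :=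
    Finset.sum_congr rfl fun x _ => Real.rpow_two _
  rw [lpNorm, h, ← Real.sqrt_eq_rpow, Real.sq_sqrt (normSq_nonneg ν)]

/-- The uniform probability measure on a nonempty finite set. -/
def uniform (A : Finset ℝ) (hA : A.Nonempty) : FinProb ℝ where
  weights := Finsupp.indicator A fun _ _ => (A.card : ℝ)⁻¹
  nonneg := fun x => by
    classical
    rw [Finsupp.indicator_apply]
    split_ifs
    · positivity
    · exact le_rfl
  total := by
    have h : (A.card : ℝ) ≠ 0 := by exact_mod_cast hA.card_ne_zero
    rw [Finsupp.sum_of_support_subset _ (Finsupp.support_indicator_subset _ _) _ fun _ _ => rfl,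
      Finset.sum_congr rfl fun x hx => Finsupp.indicator_of_mem hx _, Finset.sum_const,
      nsmul_eq_mul, mul_inv_cancel₀ h]

section uniform

variable {A : Finset ℝ} (hA : A.Nonempty)

theorem uniform_weights_of_mem {x : ℝ} (hx : x ∈ A) :
    (uniform A hA).weights x = (A.card : ℝ)⁻¹ :=
  Finsupp.indicator_of_mem hx fun _ _ => (A.card : ℝ)⁻¹

theorem uniform_weights_le (x : ℝ) : (uniform A hA).weights x ≤ (A.card : ℝ)⁻¹ := by
  by_cases hx : x ∈ A
  · exact (uniform_weights_of_mem hA hx).le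
  · exact (Finsupp.indicator_of_notMem hx fun _ _ => (A.card : ℝ)⁻¹).trans_le (by positivity)

theorem support_uniform : (uniform A hA).weights.support = A := by
  refine (Finsupp.support_indicator_subset _ _).antisymm fun x hx => ?_
  refine Finsupp.mem_support_iff.2 ((uniform_weights_of_mem hA hx).trans_ne ?_)
  exact inv_ne_zero (by exact_mod_cast hA.card_ne_zero)

theorem normSq_uniform : normSq (uniform A hA) = (A.card : ℝ)⁻¹ := by
  have h : (A.card : ℝ) ≠ 0 := by exact_mod_cast hA.card_ne_zero
  rw [normSq, support_uniform,
    Finset.sum_congr rfl fun x hx => by rw [uniform_weights_of_mem hA hx], Finset.sum_const,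
    nsmul_eq_mul]
  field_simp

theorem T_uniform :
    T (productMeasure (uniform A hA)) = (A.card : ℝ)⁻¹ ^ 8 * commPairs A := by
  have hw : ∀ X ∈ matricesOver A,
      (productMeasure (uniform A hA)).weights X = (A.card : ℝ)⁻¹ ^ 4 := by
    intro X hX
    rw [mem_matricesOver] at hX
    rw [productMeasure_apply]
    simp only [uniform_weights_of_mem hA (hX _ _)]
    ring
  rw [T, support_productMeasure, support_uniform, commPairs, Finset.card_filter,
    Finset.sum_product]
  push_cast
  rw [Finset.mul_sum]
  refine Finset.sum_congr rfl fun X hX => ?_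
  rw [Finset.mul_sum]
  refine Finset.sum_congr rfl fun Y hY => ?_
  rw [hw X hX, hw Y hY, ← pow_add]

theorem multEnergy_uniform :
    multEnergy (uniform A hA) = (A.card : ℝ)⁻¹ ^ 4 * setMultEnergy A := by
  have hw : ∀ x ∈ A \ {0}, (uniform A hA).weights x = (A.card : ℝ)⁻¹ := fun x hx =>
    uniform_weights_of_mem hA (Finset.mem_sdiff.1 hx).1
  rw [multEnergy, support_uniform, setMultEnergy, Finset.card_filter]
  simp only [Finset.sum_product]
  push_cast
  simp only [Finset.mul_sum]
  refine Finset.sum_congr rfl fun a ha => Finset.sum_congr rfl fun b hb =>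
    Finset.sum_congr rfl fun c hc => Finset.sum_congr rfl fun d hd => ?_
  rw [hw a ha, hw b hb, hw c hc, hw d hd]
  ring

end uniform

/-- The quadruples `(a, a, b, b)` alone contribute the square of the number of nonzero elements. -/
theorem sq_card_sdiff_le_setMultEnergy (A : Finset ℝ) :
    (A \ {0}).card ^ 2 ≤ setMultEnergy A := by
  rw [sq, ← Finset.card_product, setMultEnergy]
  refine Finset.card_le_card_of_injOn (fun p => (p.1, p.1, p.2, p.2)) ?_ ?_
  · rintro ⟨a, b⟩ h
    simp only [Finset.coe_product, Set.mem_prod, Finset.mem_coe] at h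
    have ha : a ≠ 0 := by simpa using (Finset.mem_sdiff.1 h.1).2
    have hb : b ≠ 0 := by simpa using (Finset.mem_sdiff.1 h.2).2
    simp only [Finset.mem_coe, Finset.mem_filter, Finset.mem_product]
    exact ⟨⟨h.1, h.1, h.2, h.2⟩, by rw [div_self ha, div_self hb]⟩
  · rintro ⟨a, b⟩ _ ⟨c, d⟩ _ h
    simp only [Prod.mk.injEq] at h ⊢
    exact ⟨h.1, h.2.2.1⟩

theorem commPairs_le {A : Finset ℝ} (hA : 2 ≤ A.card) :
    (commPairs A : ℝ) ≤ 60 * ((A.card : ℝ) ^ 4 * √(setMultEnergy A : ℝ)) := by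
  have hne : A.Nonempty := Finset.card_pos.1 (by omega)
  set n : ℝ := (A.card : ℝ) with hn
  have hn2 : (2 : ℝ) ≤ n := by rw [hn]; exact_mod_cast hA
  have hn0 : 0 < n := by linarith
  set m := √(setMultEnergy A : ℝ) with hm
  have hm0 : 0 ≤ m := Real.sqrt_nonneg _
  have hnm : n ≤ 2 * m := by
    have h₁ : A.card - 1 ≤ (A \ {0}).card := by
      simpa using Finset.le_card_sdiff ({0} : Finset ℝ) A
    have h₂ : A.card ≤ 2 * (A \ {0}).card := by omega
    have h₃ : ((A \ {0}).card : ℝ) ≤ m :=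
      Real.le_sqrt_of_sq_le (by exact_mod_cast sq_card_sdiff_le_setMultEnergy A)
    have h₄ : n ≤ 2 * ((A \ {0}).card : ℝ) := by rw [hn]; exact_mod_cast h₂
    linarith
  have h := T_productMeasure_le (uniform A hne)
  have hE : √(multEnergy (uniform A hne)) = n⁻¹ ^ 2 * m := by
    rw [multEnergy_uniform, Real.sqrt_mul (by positivity),
      show n⁻¹ ^ 4 = (n⁻¹ ^ 2) ^ 2 by ring, Real.sqrt_sq (by positivity)]
  have hz : (uniform A hne).weights 0 ^ 3 ≤ n⁻¹ ^ 3 :=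
    pow_le_pow_left₀ ((uniform A hne).weights_nonneg 0) (uniform_weights_le hne 0) 3
  rw [T_uniform, normSq_uniform, hE, ← hn] at h
  have h' : n⁻¹ ^ 8 * (commPairs A : ℝ) ≤ 12 * (n⁻¹ ^ 2 * (n⁻¹ ^ 2 * m) + n⁻¹ ^ 3 + n⁻¹ ^ 3) := by
    linarith
  calc (commPairs A : ℝ) = n ^ 8 * (n⁻¹ ^ 8 * (commPairs A : ℝ)) := by field_simp
    _ ≤ n ^ 8 * (12 * (n⁻¹ ^ 2 * (n⁻¹ ^ 2 * m) + n⁻¹ ^ 3 + n⁻¹ ^ 3)) := by gcongr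
    _ = 12 * n ^ 4 * (m + 2 * n) := by field_simp; ring
    _ ≤ 12 * n ^ 4 * (m + 2 * (2 * m)) := by gcongr
    _ = 60 * (n ^ 4 * m) := by ring

end CommutingPairs

end

theorem theorem1p2 :
    (∃ C : ℝ, 0 < C ∧ ∀ ν : CommutingPairs.FinProb ℝ,
      CommutingPairs.T (CommutingPairs.productMeasure ν) ≤
        C * (CommutingPairs.lpNorm 2 ν ^ 4 * √(CommutingPairs.multEnergy ν) +
          CommutingPairs.supNorm ν ^ 2 * CommutingPairs.multEnergy ν +
          CommutingPairs.lpNorm 2 ν ^ 6 + ν.weights 0 ^ 3)) ∧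
    (∃ C : ℝ, 0 < C ∧ ∀ A : Finset ℝ, 2 ≤ A.card →
      (CommutingPairs.commPairs A : ℝ) ≤
        C * ((A.card : ℝ) ^ 4 * √(CommutingPairs.setMultEnergy A : ℝ))) := by
  refine ⟨⟨12, by norm_num, fun ν => ?_⟩, 60, by norm_num, fun A hA =>
    CommutingPairs.commPairs_le hA⟩
  have h := CommutingPairs.T_productMeasure_le ν
  have hM := mul_nonneg (sq_nonneg (CommutingPairs.supNorm ν)) (CommutingPairs.multEnergy_nonneg ν)
  rw [← CommutingPairs.lpNorm_two_sq, ← pow_mul, ← pow_mul] at h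
  norm_num at h
  linarith
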